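/- Let $A$ be a commutative ring with $1$, let $q,Q\in A$ be invertible, and let $n\ge 0$. Let $\tilde W_n$ be the Artin–Tits braid group of type $B_n$, with generators $t,s_1,\dots,s_{n-1}$ and relations $s_1ts_1t=ts_1ts_1$, $ts_i=s_it$ $(i>1)$, $s_is_j=s_js_i$ $(|i-j|>1)$, $s_is_{i+1}s_i=s_{i+1}s_is_{i+1}$ $(1\le i\le n-2)$; $\tilde W_0$ is trivial. Let $H_n$ be the Iwahori–Hecke algebra of type $B_n$, i.e. the quotient of the group algebra $A\tilde W_n$ by the two-sided ideal generated by $t^2-(Q-1)t-Q\cdot 1$ and $s_i^2-(q-1)s_i-q\cdot 1$ $(1\le i\le n-1)$; write $t$, $g_i$ for the images of $t$, $s_i$. There are natural maps $H_n\to H_N$ $(n\le N)$, $t\mapsto t$, $g_i\mapsto g_i$, and we denote an element of $H_n$ and its image in $H_N$ by the same symbol. For $i\ge 1$ let $$\mathcal D_{i}'=\{1,\ g_{i-1},\ t'_{i-1}\},\qquad t'_{i-1}=g_{i-1}\cdots g_1\,t\,g_1^{-1}\cdots g_{i-1}^{-1},$$ and let $\mathcal D_{i,0}'$ be the set consisting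 of $1$, $g_{i-1}$ and all the elements $$g_{i-1}^{\varepsilon_{i-1}}\cdots g_1^{\varepsilon_1}\,t\,g_1^{-\varepsilon_1}\cdots g_{i-1}^{-\varepsilon_{i-1}},\qquad \varepsilon_1,\dots,\varepsilon_{i-1}\in\{1,-1\}$$ (for $i=1$ the element $g_0$ is omitted, so that $\mathcal D'_1=\mathcal D'_{1,0}=\{1,t\}$). A trace function on $H_n$ is an $A$-linear map $\varphi:H_n\to A$ with $\varphi(hh')=\varphi(h'h)$ for all $h,h'\in H_n$. **(1)** For each $h\in H_n$ there is a finite non-empty subset $I(h)\subseteq A\times\mathcal D_{1,0}'\times\cdots\times\mathcal D_{n,0}'$ such that $$\varphi(h)=\sum_{(r,d_1^*,\dots,d_n^*)\in I(h)} r\,\varphi(d_1^*\cdots d_n^*)$$ for all trace functions $\varphi$ on $H_n$. **(2)** Moreover, for each $h\in H_n$ there is a finite non-empty family $I(h)$ of elements of $A\times\mathcal D_{1,0}'\times\cdots\times\mathcal D_{n,0}'$ (repetitions allowed) for which the formula in (1) holds for all trace functions on $H_n$, and such that the following is true. For all $m\ge 0$ and all $d_{n+1}\in\mathcal D_{n+1}',\dots,d_{n+m}\in\mathcal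 D_{n+m}'$ there are, for each member of the family $I(h)$, elements $d_{n+1}^*\in\mathcal D_{n+1,0}',\dots,d_{n+m}^*\in\mathcal D_{n+m,0}'$ (depending on that member) such that $$\varphi(h\,d_{n+1}\cdots d_{n+m})=\sum_{(r,d_1^*,\dots,d_n^*)\in I(h)} r\,\varphi(d_1^*\cdots d_n^*\,d_{n+1}^*\cdots d_{n+m}^*)$$ for all trace functions $\varphi$ on $H_{n+m}$. -/

import Mathlib

/-- The defining relators of the Artin-Tits group of type `B_n` on the Dynkin diagram
`t = s_0 ═ s_1 ─ s_2 ─ ⋯ ─ s_{n-1}`. The generator with index `0 : Fin n` is `t`, the generator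
with index `i ≥ 1` is `s_i`. A relation `u = v` is written as the relator `u * v⁻¹`. -/
inductive BraidB.IsRelator (n : ℕ) : FreeGroup (Fin n) → Prop
  /-- `s_1 t s_1 t = t s_1 t s_1` -/
  | four (t s : Fin n) (ht : t.val = 0) (hs : s.val = 1) :
      BraidB.IsRelator n
        ((FreeGroup.of s * FreeGroup.of t * FreeGroup.of s * FreeGroup.of t) *
          (FreeGroup.of t * FreeGroup.of s * FreeGroup.of t * FreeGroup.of s)⁻¹)
  /-- `t s_j = s_j t` for `j > 1`, and `s_i s_j = s_j s_i` for `|i - j| > 1` -/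
  | comm (i j : Fin n) (hij : i.val + 1 < j.val) :
      BraidB.IsRelator n
        ((FreeGroup.of i * FreeGroup.of j) * (FreeGroup.of j * FreeGroup.of i)⁻¹)
  /-- `s_i s_{i+1} s_i = s_{i+1} s_i s_{i+1}` for `1 ≤ i ≤ n - 2` -/
  | three (i j : Fin n) (hi : 1 ≤ i.val) (hj : j.val = i.val + 1) :
      BraidB.IsRelator n
        ((FreeGroup.of i * FreeGroup.of j * FreeGroup.of i) *
          (FreeGroup.of j * FreeGroup.of i * FreeGroup.of j)⁻¹)

/-- The Artin-Tits braid group of type `B_n` (trivial for `n = 0`). -/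
abbrev BraidB (n : ℕ) : Type := PresentedGroup {r | BraidB.IsRelator n r}

namespace BraidB

/-- The generators: `gen 0 = t` and `gen i = s_i` for `i ≥ 1`. -/
def gen {n : ℕ} (i : Fin n) : BraidB n := PresentedGroup.of i

/-- The natural map from the braid group of type `B_n` to that of type `B_N`, for `n ≤ N`:
`t ↦ t`, `s_i ↦ s_i`. -/
def incl {n N : ℕ} (hN : n ≤ N) : BraidB n →* BraidB N :=
  PresentedGroup.toGroup (f := fun i => gen (Fin.castLE hN i)) (by
    have key : ∀ r : FreeGroup (Fin N), IsRelator N r →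
        FreeGroup.lift (gen (n := N)) r = 1 := by
      intro r hr
      have h1 : FreeGroup.lift (gen (n := N)) = PresentedGroup.mk {r | IsRelator N r} := by
        ext i
        simp [gen, PresentedGroup.of]
      rw [h1]
      exact PresentedGroup.one_of_mem hr
    intro r hr
    cases hr with
    | four t s ht hs =>
      simpa using key _ (IsRelator.four (Fin.castLE hN t) (Fin.castLE hN s) ht hs)
    | comm i j hij =>
      simpa using key _ (IsRelator.comm (Fin.castLE hN i) (Fin.castLE hN j) hij)
    | three i j hi hj =>
      simpa using key _ (IsRelator.three (Fin.castLE hN i) (Fin.castLE hN j) hi hj))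

theorem incl_gen {n N : ℕ} (hN : n ≤ N) (i : Fin n) :
    incl hN (gen i) = gen (Fin.castLE hN i) :=
  PresentedGroup.toGroup.of _

/-- For a choice of signs `ε`, the element
`s_i^{ε_i} ⋯ s_1^{ε_1} t s_1^{-ε_1} ⋯ s_i^{-ε_i}` of the braid group, where `0 ≤ i ≤ n - 1`. -/
def tConj {n : ℕ} (ε : ℕ → ℤˣ) : (i : ℕ) → i < n → BraidB n
  | 0, h => gen ⟨0, h⟩
  | i + 1, h =>
      gen ⟨i + 1, h⟩ ^ ((ε (i + 1) : ℤˣ) : ℤ) * tConj ε i (Nat.lt_of_succ_lt h) *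
        gen ⟨i + 1, h⟩ ^ (-((ε (i + 1) : ℤˣ) : ℤ))

/-- The set `𝒟'_{i+1,j} = {1, s_i} ∪ {all t'_{i,j}}` in the braid group of type `B_n`, for an
index `i : Fin n`. Here `t'_{i,j}` runs through the elements `tConj ε i` whose signs up to
index `j` are `+1`, the other signs being arbitrary. For `i = 0` there is no `s_0`, so that
`𝒟'_{1,0} = {1, t}`. -/
def dSet {n : ℕ} (j : ℕ) (i : Fin n) : Set (BraidB n) :=
  {x | x = 1 ∨ (1 ≤ i.val ∧ x = gen i) ∨
    ∃ ε : ℕ → ℤˣ, (∀ l, 1 ≤ l → l ≤ j → ε l = 1) ∧ x = tConj ε i.val i.isLt}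

end BraidB

/-- The quadratic relations `t² = (Q - 1) t + Q · 1` and `s_i² = (q - 1) s_i + q · 1` in the
group algebra of the braid group. -/
inductive HeckeB.Rel {A : Type*} [CommRing A] (q Q : Aˣ) (n : ℕ) :
    MonoidAlgebra A (BraidB n) → MonoidAlgebra A (BraidB n) → Prop
  | quad_t (i : Fin n) (hi : i.val = 0) :
      HeckeB.Rel q Q n (MonoidAlgebra.of A (BraidB n) (BraidB.gen i) ^ 2)
        (((Q : A) - 1) • MonoidAlgebra.of A (BraidB n) (BraidB.gen i) + (Q : A) • 1)
  | quad_s (i : Fin n) (hi : 1 ≤ i.val) :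
      HeckeB.Rel q Q n (MonoidAlgebra.of A (BraidB n) (BraidB.gen i) ^ 2)
        (((q : A) - 1) • MonoidAlgebra.of A (BraidB n) (BraidB.gen i) + (q : A) • 1)

/-- The Iwahori-Hecke algebra `H_n` of type `B_n` over `A` with parameters `q`, `Q`: the quotient
of the group algebra of the braid group by the two-sided ideal generated by the quadratic
relations. -/
abbrev HeckeB {A : Type*} [CommRing A] (q Q : Aˣ) (n : ℕ) : Type _ :=
  RingQuot (HeckeB.Rel q Q n)

namespace HeckeB

/-- The image in `H_n` of an element of the braid group. -/
noncomputable def ofBraid {A : Type*} [CommRing A] (q Q : Aˣ) (n : ℕ) :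
    BraidB n →* HeckeB q Q n :=
  (RingQuot.mkAlgHom A (Rel q Q n) : MonoidAlgebra A (BraidB n) →* HeckeB q Q n).comp
    (MonoidAlgebra.of A (BraidB n))

/-- The natural map `H_n → H_N` for `n ≤ N`: `t ↦ t`, `g_i ↦ g_i`. -/
noncomputable def incl {A : Type*} [CommRing A] (q Q : Aˣ) {n N : ℕ} (hN : n ≤ N) :
    HeckeB q Q n →ₐ[A] HeckeB q Q N :=
  RingQuot.liftAlgHom A
    ⟨(RingQuot.mkAlgHom A (Rel q Q N)).comp
      (MonoidAlgebra.mapDomainAlgHom A A (BraidB.incl hN)), by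
      have key : ∀ g : BraidB n,
          MonoidAlgebra.mapDomainAlgHom A A (BraidB.incl hN) (MonoidAlgebra.of A (BraidB n) g) =
            MonoidAlgebra.of A (BraidB N) (BraidB.incl hN g) := by
        intro g
        simp
      intro x y hxy
      cases hxy with
      | quad_t i hi =>
        have h2 := RingQuot.mkAlgHom_rel A (Rel.quad_t (q := q) (Q := Q) (Fin.castLE hN i) hi)
        rw [AlgHom.comp_apply, AlgHom.comp_apply, map_pow, map_add, map_smul, map_smul, map_one,
          key, BraidB.incl_gen]
        exact h2
      | quad_s i hi =>
        have h2 := RingQuot.mkAlgHom_rel A (Rel.quad_s (q := q) (Q := Q) (Fin.castLE hN i) hi)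
        rw [AlgHom.comp_apply, AlgHom.comp_apply, map_pow, map_add, map_smul, map_smul, map_one,
          key, BraidB.incl_gen]
        exact h2⟩

theorem incl_ofBraid {A : Type*} [CommRing A] (q Q : Aˣ) {n N : ℕ} (hN : n ≤ N) (x : BraidB n) :
    incl q Q hN (ofBraid q Q n x) = ofBraid q Q N (BraidB.incl hN x) := by
  simp [incl, ofBraid]

/-- The set `𝒟'_{i+1,j} = {1, g_i} ∪ {all t'_{i,j}}` in `H_n`, for an index `i : Fin n`. -/
def D {A : Type*} [CommRing A] (q Q : Aˣ) {n : ℕ} (j : ℕ) (i : Fin n) : Set (HeckeB q Q n) :=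
  ofBraid q Q n '' BraidB.dSet j i

/-- A trace function on `H_n`: an `A`-linear map `φ : H_n → A` with `φ (h h') = φ (h' h)`. -/
def IsTraceFunction {A : Type*} [CommRing A] {q Q : Aˣ} {n : ℕ} (φ : HeckeB q Q n →ₗ[A] A) :
    Prop :=
  ∀ h h' : HeckeB q Q n, φ (h * h') = φ (h' * h)

/-- The ordered product `d_0 d_1 ⋯ d_{m-1}`. -/
def orderedProd {M : Type*} [Monoid M] {m : ℕ} (d : Fin m → M) : M := (List.ofFn d).prod

end HeckeB

/-!
The proof is an induction on `n` that needs a stronger statement than the theorem, uniform in the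
factors `d_{n+k}`: `HeckeB.HasExpansion`.

Consider the elements `t'` with sign vectors `ε`. By the braid relations `s_i` commutes with such
an element if `ε_i = ε_{i+1} = 1`, it moves a sign `-` from position `i` to a position `i + 1` with
sign `+`, and `t` turns the sign at position `1` from `+` to `-`. Hence the particular coset
representatives `s_{k-1} ⋯ s_i` and `s_{k-1} ⋯ s_1 t s_1⁻¹ ⋯ s_i⁻¹` of `W_{k-1}` in `W_k` can be moved
from the left to the right of every `t'` whose first `k` signs are `+`, and this changes at most
the sign at `k`, in the same way for all these `t'` at once (`IsCosetRep.exists_actsBySigns`).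
No correction terms appear, which is what makes the length of the expansion independent of the
number of factors.

On the other hand `H_{n+1}` is spanned by products `a c` with `a ∈ H_n` and `c` a coset
representative (`HeckeB.sub_le_cosetSpan`), and each `c` is `1`, `t'_n` or `g_n b` with `b` a coset
representative of level `n`. So one has to treat `h = a δ b` with `δ ∈ {1, g_n, t'_n}`. If
`Y = d_{n+2} ⋯ d_{n+1+m}` has signs `+` at the first `n` positions, then `b Y = Y* b`, where `Y*` has
signs `+` at the first `n - 1` positions, and a trace function satisfies
`φ (a δ b Y) = φ (a δ Y* b) = φ (b a · δ Y*)`. As `b a ∈ H_n`, the induction hypothesis applies to `b a`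
with the longer sequence `δ Y*` (`HeckeB.HasExpansion.mul_mul`).
-/

/-! ### Braid relations and conjugation of the elements `t'` -/

namespace BraidB

/-- The generator with index `i`, extended by `1` to the indices `i ≥ N`, so that products over
natural-number indices need no bound proofs. -/
def natGen (N i : ℕ) : BraidB N := if h : i < N then gen ⟨i, h⟩ else 1

theorem natGen_of_lt {N i : ℕ} (h : i < N) : natGen N i = gen ⟨i, h⟩ := dif_pos h

theorem mk_relator {N : ℕ} {r : FreeGroup (Fin N)} (hr : IsRelator N r) :
    PresentedGroup.mk {r | IsRelator N r} r = 1 :=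
  PresentedGroup.one_of_mem hr

theorem natGen_commute {N i j : ℕ} (hij : i + 1 < j) : Commute (natGen N i) (natGen N j) := by
  by_cases hj : j < N
  · rw [natGen_of_lt hj, natGen_of_lt (by omega : i < N)]
    have := mk_relator (IsRelator.comm (n := N) ⟨i, by omega⟩ ⟨j, hj⟩ hij)
    rw [map_mul, map_inv, mul_inv_eq_one, map_mul, map_mul] at this
    exact this
  · simp [natGen, hj]

theorem natGen_braid {N i : ℕ} (hi : 1 ≤ i) (hN : i + 1 < N) :
    natGen N i * natGen N (i + 1) * natGen N i =
      natGen N (i + 1) * natGen N i * natGen N (i + 1) := by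
  rw [natGen_of_lt hN, natGen_of_lt (by omega : i < N)]
  have := mk_relator (IsRelator.three (n := N) ⟨i, by omega⟩ ⟨i + 1, hN⟩ hi rfl)
  rw [map_mul, map_inv, mul_inv_eq_one] at this
  simp only [map_mul] at this
  exact this

theorem natGen_four {N : ℕ} (hN : 1 < N) :
    natGen N 1 * natGen N 0 * natGen N 1 * natGen N 0 =
      natGen N 0 * natGen N 1 * natGen N 0 * natGen N 1 := by
  rw [natGen_of_lt hN, natGen_of_lt (by omega : 0 < N)]
  have := mk_relator (IsRelator.four (n := N) ⟨0, by omega⟩ ⟨1, hN⟩ rfl rfl)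
  rw [map_mul, map_inv, mul_inv_eq_one] at this
  simp only [map_mul] at this
  exact this

/-- The element `s_i^{ε_i} ⋯ s_1^{ε_1} t s_1^{-ε_1} ⋯ s_i^{-ε_i}`, as `BraidB.tConj` but without a
bound on the index. -/
def natConj (N : ℕ) (ε : ℕ → ℤˣ) : ℕ → BraidB N
  | 0 => natGen N 0
  | i + 1 => natGen N (i + 1) ^ ((ε (i + 1) : ℤˣ) : ℤ) * natConj N ε i *
      (natGen N (i + 1) ^ ((ε (i + 1) : ℤˣ) : ℤ))⁻¹

theorem natConj_eq_tConj {N : ℕ} (ε : ℕ → ℤˣ) :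
    ∀ (i : ℕ) (h : i < N), natConj N ε i = tConj ε i h
  | 0, h => natGen_of_lt h
  | i + 1, h => by
    rw [natConj, tConj, natConj_eq_tConj ε i (by omega), natGen_of_lt h, zpow_neg]

theorem natConj_congr {N : ℕ} {ε ε' : ℕ → ℤˣ} :
    ∀ {l : ℕ}, (∀ i, 1 ≤ i → i ≤ l → ε i = ε' i) → natConj N ε l = natConj N ε' l
  | 0, _ => rfl
  | l + 1, h => by
    rw [natConj, natConj, natConj_congr (fun i h1 h2 => h i h1 (by omega)),
      h (l + 1) (by omega) le_rfl]

theorem natGen_commute_natConj {N j : ℕ} (ε : ℕ → ℤˣ) :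
    ∀ {k : ℕ}, k + 1 < j → Commute (natGen N j) (natConj N ε k)
  | 0, h => (natGen_commute h).symm
  | k + 1, h => by
    have h1 : Commute (natGen N j) (natGen N (k + 1) ^ ((ε (k + 1) : ℤˣ) : ℤ)) :=
      (natGen_commute h).symm.zpow_right _
    exact (h1.mul_right (natGen_commute_natConj ε (by omega))).mul_right h1.inv_right

/-- Conjugating relations between the elements `t'` propagate to higher indices, as long as the
conjugating element commutes with the additional generators. -/
theorem semiconjBy_natConj_of_le {N l₀ l : ℕ} {x : BraidB N} {ε ε' : ℕ → ℤˣ}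
    (h₀ : SemiconjBy x (natConj N ε l₀) (natConj N ε' l₀))
    (hx : ∀ j, l₀ < j → Commute x (natGen N j)) (hε : ∀ j, l₀ < j → ε j = ε' j) (hl : l₀ ≤ l) :
    SemiconjBy x (natConj N ε l) (natConj N ε' l) := by
  induction l, hl using Nat.le_induction with
  | base => exact h₀
  | succ l hl ih =>
    have h1 := (hx (l + 1) (by omega)).zpow_right ((ε (l + 1) : ℤˣ) : ℤ)
    rw [natConj, natConj, ← hε (l + 1) (by omega)]
    exact (SemiconjBy.mul_right h1 ih).mul_right h1.inv_right

theorem mulSingle_mul_apply_of_ne {k j : ℕ} (ε : ℕ → ℤˣ) (h : j ≠ k) :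
    (Pi.mulSingle k (-1) * ε : ℕ → ℤˣ) j = ε j := by
  rw [Pi.mul_apply, Pi.mulSingle_eq_of_ne h, one_mul]

/-- `t` turns the first sign of `t'` from `+` to `-`; this is the relation of length four. -/
theorem semiconjBy_natGen_zero {N l : ℕ} {ε : ℕ → ℤˣ} (hε : ε 1 = 1) (hl : 1 ≤ l) (hN : l < N) :
    SemiconjBy (natGen N 0) (natConj N ε l) (natConj N (Pi.mulSingle 1 (-1) * ε) l) := by
  refine semiconjBy_natConj_of_le (l₀ := 1) ?_ (fun j hj => natGen_commute (by omega))
    (fun j hj => (mulSingle_mul_apply_of_ne ε (by omega)).symm) hl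
  have h4 := natGen_four (N := N) (by omega)
  simp only [natConj, Nat.zero_add, Pi.mul_apply, Pi.mulSingle_eq_same, hε, SemiconjBy]
  simp only [Units.val_one, zpow_one, mul_one, Units.val_neg, zpow_neg, inv_inv]
  rw [mul_assoc, mul_assoc, mul_assoc, eq_inv_mul_iff_mul_eq, ← mul_assoc, ← mul_assoc, ← mul_assoc,
    ← mul_assoc, h4, mul_inv_cancel_right]

theorem semiconjBy_conj {G : Type*} [Group G] {x y X a b : G} (h : x * a = b * y)
    (hy : Commute y X) : SemiconjBy x (a * X * a⁻¹) (b * X * b⁻¹) := by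
  have hx : x = b * y * a⁻¹ := by rw [← h, mul_inv_cancel_right]
  have hy' : y * X = X * y := hy
  rw [SemiconjBy, hx]
  simp only [mul_assoc, inv_mul_cancel_left]
  rw [← mul_assoc y X, hy', mul_assoc]

/-- `s_i` commutes with `t'` if the signs at `i` and `i + 1` are both `+`. -/
theorem natGen_commute_natConj_of_one {N i l : ℕ} {ε : ℕ → ℤˣ} (hi : 1 ≤ i) (hil : i < l)
    (hN : l < N) (h0 : ε i = 1) (h1 : ε (i + 1) = 1) :
    Commute (natGen N i) (natConj N ε l) := by
  refine semiconjBy_natConj_of_le (l₀ := i + 1) ?_ (fun j hj => natGen_commute (by omega))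
    (fun _ _ => rfl) hil
  obtain ⟨j, rfl⟩ : ∃ j, i = j + 1 := ⟨i - 1, by omega⟩
  have h3 := natGen_braid (N := N) hi (by omega)
  have := semiconjBy_conj (x := natGen N (j + 1)) (a := natGen N (j + 1 + 1) * natGen N (j + 1))
    (b := natGen N (j + 1 + 1) * natGen N (j + 1)) (by rw [← h3, mul_assoc])
    (natGen_commute_natConj (N := N) ε (k := j) (by omega : j + 1 < j + 1 + 1))
  simpa [natConj, h0, h1, mul_assoc] using this

/-- `s_i` moves a sign `-` from position `i` to position `i + 1`. -/
theorem semiconjBy_natGen {N i l : ℕ} {ε : ℕ → ℤˣ} (hi : 1 ≤ i) (hil : i < l)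
    (hN : l < N) (h0 : ε i = 1) (h1 : ε (i + 1) = 1) :
    SemiconjBy (natGen N i) (natConj N (Pi.mulSingle i (-1) * ε) l)
      (natConj N (Pi.mulSingle (i + 1) (-1) * ε) l) := by
  refine semiconjBy_natConj_of_le (l₀ := i + 1) ?_ (fun j hj => natGen_commute (by omega))
    (fun j hj => by
      rw [mulSingle_mul_apply_of_ne ε (by omega), mulSingle_mul_apply_of_ne ε (by omega)]) hil
  obtain ⟨j, rfl⟩ : ∃ j, i = j + 1 := ⟨i - 1, by omega⟩
  have h3 := natGen_braid (N := N) hi (by omega)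
  have hc : ∀ k, j < k → natConj N (Pi.mulSingle k (-1) * ε) j = natConj N ε j := fun k hk =>
    natConj_congr fun i _ h2 => mulSingle_mul_apply_of_ne ε (by omega)
  have := semiconjBy_conj (x := natGen N (j + 1)) (a := natGen N (j + 1 + 1) * (natGen N (j + 1))⁻¹)
    (b := (natGen N (j + 1 + 1))⁻¹ * natGen N (j + 1)) (y := natGen N (j + 1 + 1)) (by
      rw [mul_assoc, eq_inv_mul_iff_mul_eq, ← mul_assoc, ← mul_assoc, ← h3,
        mul_inv_cancel_right])
    (natGen_commute_natConj (N := N) ε (k := j) (by omega : j + 1 < j + 1 + 1))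
  simpa [natConj, h0, h1, mul_assoc, Pi.mulSingle_apply, hc] using this

/-- Representatives of the right cosets of `W_{k-1}` in `W_k`, lifted to the braid group:
`s_{k-1} ⋯ s_i` (including the empty product) and `s_{k-1} ⋯ s_1 t s_1⁻¹ ⋯ s_i⁻¹`. The recursion reads
`C_{k+1} = {1, t'_k} ∪ s_k C_k`. -/
inductive IsCosetRep (N : ℕ) : ℕ → BraidB N → Prop
  | one (k : ℕ) : IsCosetRep N k 1
  | conj (k : ℕ) : IsCosetRep N (k + 1) (natConj N 1 k)
  | gen_mul (k : ℕ) (c : BraidB N) (hc : IsCosetRep N k c) :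
      IsCosetRep N (k + 1) (natGen N k * c)

theorem IsCosetRep.commute {N k j : ℕ} {c : BraidB N} (hc : IsCosetRep N k c) (hj : k < j) :
    Commute c (natGen N j) := by
  induction hc with
  | one k => exact Commute.one_left _
  | conj k => exact (natGen_commute_natConj 1 hj).symm
  | gen_mul k c hc ih => exact (natGen_commute hj).mul_left (ih (by omega))

/-- `c` acts on the elements `t'` whose first `k` signs are `+` by multiplication with the sign
vector `s`. -/
def ActsBySigns {N : ℕ} (k : ℕ) (c : BraidB N) (s : ℕ → ℤˣ) : Prop :=
  ∀ ε : ℕ → ℤˣ, (∀ i, 1 ≤ i → i ≤ k → ε i = 1) → ∀ l, k ≤ l → l < N →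
    SemiconjBy c (natConj N ε l) (natConj N (s * ε) l)

theorem ActsBySigns.one {N k : ℕ} : ActsBySigns k (1 : BraidB N) 1 := fun ε _ l _ _ => by
  rw [one_mul]; exact SemiconjBy.one_left _

theorem ActsBySigns.gen_mul_one {N k : ℕ} (hk : 1 ≤ k) {c : BraidB N}
    (h : ActsBySigns k c 1) : ActsBySigns (k + 1) (natGen N k * c) 1 := fun ε hε l hl hN => by
  have h1 := h ε (fun i h1 h2 => hε i h1 (by omega)) l (by omega) hN
  rw [one_mul] at h1 ⊢
  exact SemiconjBy.mul_left (natGen_commute_natConj_of_one hk (by omega) hN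
    (hε k hk (by omega)) (hε (k + 1) (by omega) le_rfl)) h1

/-- Multiplication by `s_k` moves the sign `-` from `k` to `k + 1`. -/
theorem ActsBySigns.gen_mul_single {N k : ℕ} (hk : 1 ≤ k) {c : BraidB N}
    (h : ActsBySigns k c (Pi.mulSingle k (-1))) :
    ActsBySigns (k + 1) (natGen N k * c) (Pi.mulSingle (k + 1) (-1)) := fun ε hε l hl hN =>
  SemiconjBy.mul_left (semiconjBy_natGen hk (by omega) hN
    (hε k hk (by omega)) (hε (k + 1) (by omega) le_rfl))
    (h ε (fun i h1 h2 => hε i h1 (by omega)) l (by omega) hN)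

theorem actsBySigns_natGen_zero {N : ℕ} :
    ActsBySigns 1 (natGen N 0) (Pi.mulSingle 1 (-1)) := fun _ hε _ hl hN =>
  semiconjBy_natGen_zero (hε 1 le_rfl le_rfl) hl hN

theorem actsBySigns_natConj {N : ℕ} (k : ℕ) :
    ActsBySigns (k + 1) (natConj N 1 k) (Pi.mulSingle (k + 1) (-1)) := by
  induction k with
  | zero => exact actsBySigns_natGen_zero
  | succ k ih =>
    intro ε hε l hl hN
    have h1 : Commute (natGen N (k + 1))⁻¹ (natConj N ε l) :=
      (natGen_commute_natConj_of_one (by omega) (by omega) hN (hε _ (by omega) (by omega))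
        (hε _ (by omega) le_rfl)).inv_left
    simpa [natConj] using
      SemiconjBy.mul_left (ih.gen_mul_single (by omega) ε hε l hl hN) h1

theorem incl_natGen {n N i : ℕ} (hN : n ≤ N) (hi : i < n) :
    incl hN (natGen n i) = natGen N i := by
  rw [natGen_of_lt hi, natGen_of_lt (hi.trans_le hN), incl_gen]
  rfl

theorem incl_natConj {n N : ℕ} (hN : n ≤ N) (ε : ℕ → ℤˣ) :
    ∀ {k : ℕ}, k < n → incl hN (natConj n ε k) = natConj N ε k
  | 0, hk => incl_natGen hN hk
  | k + 1, hk => by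
    rw [natConj, natConj, map_mul, map_mul, map_inv, map_zpow, incl_natGen hN hk,
      incl_natConj hN ε (by omega)]

/-- A coset representative moves past the elements `t'` with `k` leading signs `+` at the cost of
at most the sign at `k`; that cost is the same in all the groups that contain the representative. -/
theorem IsCosetRep.exists_actsBySigns {n k : ℕ} {c : BraidB n} (hc : IsCosetRep n k c)
    (hk : k ≤ n) : ∃ s : ℕ → ℤˣ, (s = 1 ∨ s = Pi.mulSingle k (-1)) ∧
      ∀ (N : ℕ) (hN : n ≤ N), ActsBySigns k (incl hN c) s := by
  induction hc with
  | one k => exact ⟨1, Or.inl rfl, fun N hN => by rw [map_one]; exact ActsBySigns.one⟩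
  | conj k =>
    exact ⟨_, Or.inr rfl, fun N hN => by rw [incl_natConj hN 1 hk]; exact actsBySigns_natConj k⟩
  | gen_mul k c hc ih =>
    rcases Nat.eq_zero_or_pos k with rfl | h0
    · cases hc
      refine ⟨_, Or.inr rfl, fun N hN => ?_⟩
      rw [mul_one, incl_natGen hN hk]
      exact actsBySigns_natGen_zero
    · obtain ⟨s, rfl | rfl, h⟩ := ih (by omega)
      · refine ⟨_, Or.inl rfl, fun N hN => ?_⟩
        rw [map_mul, incl_natGen hN hk]
        exact (h N hN).gen_mul_one h0
      · refine ⟨_, Or.inr rfl, fun N hN => ?_⟩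
        rw [map_mul, incl_natGen hN hk]
        exact (h N hN).gen_mul_single h0

theorem incl_incl {n k N : ℕ} (hnk : n ≤ k) (hkN : k ≤ N) (x : BraidB n) :
    incl hkN (incl hnk x) = incl (hnk.trans hkN) x := by
  have h : (incl hkN).comp (incl hnk) = incl (hnk.trans hkN) :=
    PresentedGroup.ext fun i => by
      change incl hkN (incl hnk (gen i)) = incl _ (gen i)
      rw [incl_gen, incl_gen, incl_gen]
      rfl
  exact DFunLike.congr_fun h x

theorem IsCosetRep.map_incl {n N k : ℕ} (hN : n ≤ N) {c : BraidB n} (hc : IsCosetRep n k c)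
    (hk : k ≤ n) : IsCosetRep N k (incl hN c) := by
  induction hc with
  | one k => rw [map_one]; exact .one k
  | conj k => rw [incl_natConj hN 1 hk]; exact .conj k
  | gen_mul k c hc ih =>
    rw [map_mul, incl_natGen hN hk]
    exact .gen_mul k _ (ih (by omega))

theorem IsCosetRep.exists_incl_eq {n N k : ℕ} (hN : n ≤ N) {c : BraidB N}
    (hc : IsCosetRep N k c) (hk : k ≤ n) : ∃ c₀, IsCosetRep n k c₀ ∧ incl hN c₀ = c := by
  induction hc with
  | one k => exact ⟨1, .one k, map_one _⟩
  | conj k => exact ⟨_, .conj k, incl_natConj hN 1 hk⟩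
  | gen_mul k c hc ih =>
    obtain ⟨c₀, h₀, rfl⟩ := ih (by omega)
    exact ⟨_, .gen_mul k c₀ h₀, by rw [map_mul, incl_natGen hN hk]⟩

end BraidB

/-! ### Coset representatives span the Hecke algebra over the preceding one -/

namespace HeckeB

open BraidB

variable {A : Type*} [CommRing A] {q Q : Aˣ} {N : ℕ}

/-- The quadratic relation in the form `g = r g⁻¹ + (r - 1)`, where `r` is `Q` or `q`. -/
theorem exists_ofBraid_natGen_eq (q Q : Aˣ) {i : ℕ} (hi : i < N) :
    ∃ r : Aˣ, ofBraid q Q N (natGen N i) =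
      (r : A) • ofBraid q Q N (natGen N i)⁻¹ + ((r : A) - 1) • 1 := by
  have key : ∃ r : Aˣ, ofBraid q Q N (natGen N i) * ofBraid q Q N (natGen N i) =
      ((r : A) - 1) • ofBraid q Q N (natGen N i) + (r : A) • 1 := by
    rw [natGen_of_lt hi]
    rcases Nat.eq_zero_or_pos i with h0 | h0
    · have h := RingQuot.mkAlgHom_rel A (Rel.quad_t (q := q) (Q := Q) (n := N) ⟨i, hi⟩ h0)
      rw [map_pow, map_add, map_smul, map_smul, map_one, pow_two] at h
      exact ⟨Q, h⟩
    · have h := RingQuot.mkAlgHom_rel A (Rel.quad_s (q := q) (Q := Q) (n := N) ⟨i, hi⟩ h0)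
      rw [map_pow, map_add, map_smul, map_smul, map_one, pow_two] at h
      exact ⟨q, h⟩
  obtain ⟨r, h⟩ := key
  have hinv : ofBraid q Q N (natGen N i) * ofBraid q Q N (natGen N i)⁻¹ = 1 := by
    rw [← map_mul, mul_inv_cancel, map_one]
  have h2 := congrArg (· * ofBraid q Q N (natGen N i)⁻¹) h
  simp only [mul_assoc, add_mul, smul_mul_assoc, one_mul, hinv, mul_one] at h2
  exact ⟨r, by rw [h2, add_comm]⟩

/-- The image of `H_k` in `H_N` for `k ≤ N`: the subalgebra generated by the first `k` generators. -/
noncomputable def sub (q Q : Aˣ) (N k : ℕ) : Subalgebra A (HeckeB q Q N) :=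
  Algebra.adjoin A {x | ∃ i < k, x = ofBraid q Q N (natGen N i)}

theorem natGen_mem_sub {k i : ℕ} (hi : i < k) : ofBraid q Q N (natGen N i) ∈ sub q Q N k :=
  Algebra.subset_adjoin ⟨i, hi, rfl⟩

theorem sub_mono {k l : ℕ} (h : k ≤ l) : sub q Q N k ≤ sub q Q N l :=
  Algebra.adjoin_mono fun _ ⟨i, hi, hx⟩ => ⟨i, hi.trans_le h, hx⟩

theorem natGen_inv_mem_sub {k i : ℕ} (hi : i < k) :
    ofBraid q Q N (natGen N i)⁻¹ ∈ sub q Q N k := by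
  by_cases hN : i < N
  · obtain ⟨r, h⟩ := exists_ofBraid_natGen_eq q Q hN
    have : ofBraid q Q N (natGen N i)⁻¹ =
        ((r⁻¹ : Aˣ) : A) • (ofBraid q Q N (natGen N i) - ((r : A) - 1) • 1) := by
      rw [h, add_sub_cancel_right, smul_smul, Units.inv_mul, one_smul]
    rw [this]
    exact Subalgebra.smul_mem _ (Subalgebra.sub_mem _ (natGen_mem_sub hi)
      (Subalgebra.smul_mem _ (Subalgebra.one_mem _) _)) _
  · simp [natGen, hN]

theorem natConj_one_mem_sub {k : ℕ} : ∀ {i : ℕ}, i < k →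
    ofBraid q Q N (natConj N 1 i) ∈ sub q Q N k
  | 0, h => natGen_mem_sub h
  | i + 1, h => by
    simp only [natConj, Pi.one_apply, Units.val_one, zpow_one, map_mul]
    exact mul_mem (mul_mem (natGen_mem_sub h) (natConj_one_mem_sub (by omega)))
      (natGen_inv_mem_sub h)

theorem _root_.BraidB.IsCosetRep.mem_sub {k : ℕ} {c : BraidB N} (hc : IsCosetRep N k c) :
    ofBraid q Q N c ∈ sub q Q N k := by
  induction hc with
  | one k => rw [map_one]; exact one_mem _
  | conj k => exact natConj_one_mem_sub (Nat.lt_succ_self k)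
  | gen_mul k c hc ih =>
    rw [map_mul]
    exact mul_mem (natGen_mem_sub (Nat.lt_succ_self k)) (sub_mono (Nat.le_succ k) ih)

theorem mem_sub_zero {a : HeckeB q Q N} (ha : a ∈ sub q Q N 0) :
    ∃ r : A, algebraMap A (HeckeB q Q N) r = a := by
  have h0 : sub q Q N 0 = ⊥ := by
    rw [sub]
    convert Algebra.adjoin_empty A (HeckeB q Q N)
    simp
  rw [h0] at ha
  exact Algebra.mem_bot.1 ha

theorem commute_of_mem_sub {k j : ℕ} {a : HeckeB q Q N} (ha : a ∈ sub q Q N k) (hj : k < j) :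
    Commute a (ofBraid q Q N (natGen N j)) := by
  refine Algebra.adjoin_induction (p := fun a _ => Commute a (ofBraid q Q N (natGen N j)))
    ?_ ?_ ?_ ?_ ha
  · rintro x ⟨i, hi, rfl⟩
    exact (natGen_commute (by omega)).map (ofBraid q Q N)
  · exact fun r => Algebra.commutes r _
  · exact fun x y _ _ hx hy => hx.add_left hy
  · exact fun x y _ _ hx hy => hx.mul_left hy

theorem sub_self : sub q Q N N = ⊤ := by
  have hgen : ∀ x : BraidB N,
      ofBraid q Q N x ∈ sub q Q N N ∧ ofBraid q Q N x⁻¹ ∈ sub q Q N N := by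
    intro x
    have hx : x ∈ Subgroup.closure (Set.range (PresentedGroup.of
        (rels := {r | IsRelator N r}))) := by
      rw [PresentedGroup.closure_range_of]; trivial
    induction hx using Subgroup.closure_induction with
    | mem x hx =>
      obtain ⟨i, rfl⟩ := hx
      have h : PresentedGroup.of (rels := {r | IsRelator N r}) i = natGen N i :=
        (natGen_of_lt i.isLt).symm
      rw [h]
      exact ⟨natGen_mem_sub i.isLt, natGen_inv_mem_sub i.isLt⟩
    | one => simp [one_mem]
    | mul x y _ _ hx hy =>
      rw [mul_inv_rev, map_mul, map_mul]
      exact ⟨mul_mem hx.1 hy.1, mul_mem hy.2 hx.2⟩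
    | inv x _ hx => rw [inv_inv]; exact hx.symm
  refine eq_top_iff.2 fun y _ => ?_
  obtain ⟨y, rfl⟩ := RingQuot.mkAlgHom_surjective A (Rel q Q N) y
  induction y using MonoidAlgebra.induction_on with
  | of x => exact (hgen x).1
  | add x y hx hy => rw [map_add]; exact add_mem (hx trivial) (hy trivial)
  | smul r x hx => rw [map_smul]; exact Subalgebra.smul_mem _ (hx trivial) r

/-- The span of the products `a c` with `a ∈ H_{k-1}` and `c` a coset representative of level
`k`. (For `k = 0` the truncated index makes `a` range over `H_0 = A`.) -/
noncomputable def cosetSpan (q Q : Aˣ) (N k : ℕ) : Submodule A (HeckeB q Q N) :=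
  Submodule.span A {x | ∃ a ∈ sub q Q N (k - 1), ∃ c, IsCosetRep N k c ∧ x = a * ofBraid q Q N c}

/-- The sub-bimodule `H_k g_k H_k`. -/
noncomputable def genSpan (q Q : Aˣ) (N k : ℕ) : Submodule A (HeckeB q Q N) :=
  Submodule.span A {x | ∃ a ∈ sub q Q N k, ∃ b ∈ sub q Q N k,
    x = a * ofBraid q Q N (natGen N k) * b}

theorem mem_genSpan {k : ℕ} {a b : HeckeB q Q N} (ha : a ∈ sub q Q N k) (hb : b ∈ sub q Q N k) :
    a * ofBraid q Q N (natGen N k) * b ∈ genSpan q Q N k :=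
  Submodule.subset_span ⟨a, ha, b, hb, rfl⟩

theorem mem_cosetSpan {k : ℕ} {a : HeckeB q Q N} (ha : a ∈ sub q Q N (k - 1)) {c : BraidB N}
    (hc : IsCosetRep N k c) : a * ofBraid q Q N c ∈ cosetSpan q Q N k :=
  Submodule.subset_span ⟨a, ha, c, hc, rfl⟩

theorem mul_mem_cosetSpan {k : ℕ} {a x : HeckeB q Q N} (ha : a ∈ sub q Q N (k - 1))
    (hx : x ∈ cosetSpan q Q N k) : a * x ∈ cosetSpan q Q N k := by
  induction hx using Submodule.span_induction with
  | mem x hx =>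
    obtain ⟨b, hb, c, hc, rfl⟩ := hx
    rw [← mul_assoc]
    exact mem_cosetSpan (mul_mem ha hb) hc
  | zero => rw [mul_zero]; exact zero_mem _
  | add x y _ _ hx hy => rw [mul_add]; exact add_mem hx hy
  | smul r x _ hx => rw [mul_smul_comm]; exact Submodule.smul_mem _ r hx

/-- Conjugation by `g_{k+1}` carries `H_k g_k H_k` into `H_{k+1} g_{k+1} H_{k+1}`, by
`g_{k+1} g_k g_{k+1}⁻¹ = g_k⁻¹ g_{k+1} g_k`. -/
theorem conj_mem_genSpan {k : ℕ} (hk : 1 ≤ k) (hN : k + 1 < N) {x : HeckeB q Q N}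
    (hx : x ∈ genSpan q Q N k) :
    ofBraid q Q N (natGen N (k + 1)) * x * ofBraid q Q N (natGen N (k + 1))⁻¹ ∈
      genSpan q Q N (k + 1) := by
  induction hx using Submodule.span_induction with
  | mem x hx =>
    obtain ⟨a, ha, b, hb, rfl⟩ := hx
    have h1 := (commute_of_mem_sub ha (Nat.lt_succ_self k)).eq
    have h2 : b * ofBraid q Q N (natGen N (k + 1))⁻¹ =
        ofBraid q Q N (natGen N (k + 1))⁻¹ * b := by
      have h := (commute_of_mem_sub hb (Nat.lt_succ_self k)).eq
      calc b * ofBraid q Q N (natGen N (k + 1))⁻¹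
          = ofBraid q Q N (natGen N (k + 1))⁻¹ * (ofBraid q Q N (natGen N (k + 1)) * b) *
              ofBraid q Q N (natGen N (k + 1))⁻¹ := by
            rw [← mul_assoc, ← map_mul, inv_mul_cancel, map_one, one_mul]
        _ = _ := by
            rw [← h, mul_assoc, mul_assoc, ← map_mul, mul_inv_cancel, map_one, mul_one]
    have h3 : natGen N (k + 1) * natGen N k * (natGen N (k + 1))⁻¹ =
        (natGen N k)⁻¹ * natGen N (k + 1) * natGen N k := by
      rw [mul_inv_eq_iff_eq_mul, mul_assoc, mul_assoc, eq_inv_mul_iff_mul_eq, ← mul_assoc,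
        ← mul_assoc, natGen_braid hk hN]
    have h4 := congrArg (ofBraid q Q N) h3
    rw [map_mul, map_mul, map_mul, map_mul] at h4
    have : ofBraid q Q N (natGen N (k + 1)) * (a * ofBraid q Q N (natGen N k) * b) *
        ofBraid q Q N (natGen N (k + 1))⁻¹ =
        (a * ofBraid q Q N (natGen N k)⁻¹) * ofBraid q Q N (natGen N (k + 1)) *
          (ofBraid q Q N (natGen N k) * b) := by
      calc _ = (ofBraid q Q N (natGen N (k + 1)) * a) * ofBraid q Q N (natGen N k) *
            (b * ofBraid q Q N (natGen N (k + 1))⁻¹) := by simp only [mul_assoc]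
        _ = a * (ofBraid q Q N (natGen N (k + 1)) * ofBraid q Q N (natGen N k) *
            ofBraid q Q N (natGen N (k + 1))⁻¹) * b := by
          rw [← h1, h2]; simp only [mul_assoc]
        _ = _ := by rw [h4]; simp only [mul_assoc]
    rw [this]
    exact mem_genSpan
      (mul_mem (sub_mono (Nat.le_succ k) ha) (natGen_inv_mem_sub (Nat.lt_succ_self k)))
      (mul_mem (natGen_mem_sub (Nat.lt_succ_self k)) (sub_mono (Nat.le_succ k) hb))
  | zero => rw [mul_zero, zero_mul]; exact zero_mem _
  | add x y _ _ hx hy => rw [mul_add, add_mul]; exact add_mem hx hy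
  | smul r x _ hx =>
    rw [mul_smul_comm, smul_mul_assoc]; exact Submodule.smul_mem _ r hx

/-- `t'_k` and `t` commute modulo `H_k g_k H_k`. -/
theorem natConj_mul_sub_mem_genSpan {k : ℕ} (hk : 1 ≤ k) (hN : k < N) :
    ofBraid q Q N (natConj N 1 k) * ofBraid q Q N (natGen N 0) -
      ofBraid q Q N (natGen N 0) * ofBraid q Q N (natConj N 1 k) ∈ genSpan q Q N k := by
  induction k, hk using Nat.le_induction with
  | base =>
    obtain ⟨r, hr⟩ := exists_ofBraid_natGen_eq q Q hN
    simp only [natConj, Nat.zero_add, Pi.one_apply, Units.val_one, zpow_one, map_mul]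
    have h4 := congrArg (ofBraid q Q N) (natGen_four hN)
    simp only [map_mul] at h4
    set g := ofBraid q Q N (natGen N 1)
    set g' := ofBraid q Q N (natGen N 1)⁻¹
    set t := ofBraid q Q N (natGen N 0)
    have hg' : g' = ((r⁻¹ : Aˣ) : A) • (g - ((r : A) - 1) • 1) := by
      rw [hr, add_sub_cancel_right, smul_smul, Units.inv_mul, one_smul]
    have : g * t * g' * t - t * (g * t * g') =
        (((r⁻¹ : Aˣ) : A) * ((r : A) - 1)) • (t * g * t - 1 * g * (t * t)) := by
      rw [hg']
      simp only [mul_sub, sub_mul, mul_smul_comm, smul_mul_assoc, smul_sub, smul_smul, mul_one,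
        one_mul, ← mul_assoc, h4]
      abel
    rw [this]
    have ht : t ∈ sub q Q N 1 := natGen_mem_sub Nat.zero_lt_one
    exact Submodule.smul_mem _ _ (sub_mem (mem_genSpan ht ht)
      (mem_genSpan (one_mem _) (mul_mem ht ht)))
  | succ k hk ih =>
    have h := conj_mem_genSpan hk hN (ih (by omega))
    have hc : Commute (natGen N 0) (natGen N (k + 1)) := natGen_commute (by omega)
    have h1 := hc.map (ofBraid q Q N)
    have h2 := hc.inv_right.map (ofBraid q Q N)
    simp only [natConj, Pi.one_apply, Units.val_one, zpow_one, map_mul]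
    convert h using 1
    rw [mul_sub, sub_mul]
    congr 1
    · simp only [mul_assoc, h2.eq]
    · simp only [← mul_assoc, h1.eq]

/-- Left multiplication by `g_k` raises the level of `cosetSpan`: elements of `H_{k-1}` commute
with `g_k`. -/
theorem gen_mul_mem_cosetSpan {k : ℕ} {b : HeckeB q Q N} (hb : b ∈ cosetSpan q Q N k) :
    ofBraid q Q N (natGen N k) * b ∈ cosetSpan q Q N (k + 1) := by
  induction hb using Submodule.span_induction with
  | mem x hx =>
    obtain ⟨a, ha, c, hc, rfl⟩ := hx
    -- For `k = 0` the subalgebra `H_{k-1}` is `H_0 = A`, so it is still central.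
    have hcomm : Commute a (ofBraid q Q N (natGen N k)) := by
      rcases Nat.eq_zero_or_pos k with rfl | hk0
      · obtain ⟨r, rfl⟩ := mem_sub_zero ha
        exact Algebra.commute_algebraMap_left r _
      · exact commute_of_mem_sub ha (by omega)
    rw [← mul_assoc, ← hcomm.eq, mul_assoc, ← map_mul]
    have ha' : a ∈ sub q Q N k := sub_mono (Nat.sub_le k 1) ha
    exact mem_cosetSpan (k := k + 1) ha' (.gen_mul k c hc)
  | zero => rw [mul_zero]; exact Submodule.zero_mem _
  | add x y _ _ hx hy => rw [mul_add]; exact Submodule.add_mem _ hx hy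
  | smul r x _ hx => rw [mul_smul_comm]; exact Submodule.smul_mem _ r hx

theorem sub_le_cosetSpan_succ {k : ℕ} : ∀ a ∈ sub q Q N k, a ∈ cosetSpan q Q N (k + 1) :=
  fun a ha => by
    have h := mem_cosetSpan (k := k + 1) ha (.one (N := N) (k + 1))
    rwa [map_one, mul_one] at h

theorem natConj_mem_cosetSpan {k : ℕ} :
    ofBraid q Q N (natConj N 1 k) ∈ cosetSpan q Q N (k + 1) := by
  have h := mem_cosetSpan (q := q) (Q := Q) (one_mem _) (IsCosetRep.conj (N := N) k)
  rwa [one_mul] at h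

theorem natGen_mem_cosetSpan {k : ℕ} (ih : ∀ x ∈ sub q Q N k, x ∈ cosetSpan q Q N k) :
    ofBraid q Q N (natGen N k) ∈ cosetSpan q Q N (k + 1) := by
  have h := gen_mul_mem_cosetSpan (ih 1 (one_mem _))
  rwa [mul_one] at h

theorem genSpan_le_cosetSpan {k : ℕ} (ih : ∀ x ∈ sub q Q N k, x ∈ cosetSpan q Q N k) :
    genSpan q Q N k ≤ cosetSpan q Q N (k + 1) := by
  refine Submodule.span_le.2 ?_
  rintro _ ⟨a, ha, b, hb, rfl⟩
  rw [mul_assoc]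
  exact mul_mem_cosetSpan (k := k + 1) ha (gen_mul_mem_cosetSpan (ih b hb))

theorem ofBraid_natConj_succ (j : ℕ) : ofBraid q Q N (natConj N 1 (j + 1)) =
    ofBraid q Q N (natGen N (j + 1)) * ofBraid q Q N (natConj N 1 j) *
      ofBraid q Q N (natGen N (j + 1))⁻¹ := by
  simp only [natConj, Pi.one_apply, Units.val_one, zpow_one, map_mul]

theorem gen_mul_self_mem_cosetSpan {k : ℕ} (hk : k < N)
    (ih : ∀ x ∈ sub q Q N k, x ∈ cosetSpan q Q N k) :
    ofBraid q Q N (natGen N k) * ofBraid q Q N (natGen N k) ∈ cosetSpan q Q N (k + 1) := by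
  obtain ⟨r, hr⟩ := exists_ofBraid_natGen_eq q Q (N := N) (i := k) hk
  nth_rw 2 [hr]
  rw [mul_add, mul_smul_comm, mul_smul_comm, ← map_mul, mul_inv_cancel, map_one, mul_one]
  exact Submodule.add_mem _ (Submodule.smul_mem _ _ (sub_le_cosetSpan_succ 1 (one_mem _)))
    (Submodule.smul_mem _ _ (natGen_mem_cosetSpan ih))

/-- `g_{j+1} t'_j g_{j+1}` is `t'_{j+1}` up to a unit and an element of `H_{j+1} g_{j+1} H_{j+1}`. -/
theorem gen_mul_natConj_mul_gen_mem_cosetSpan {j : ℕ} (hj : j + 1 < N)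
    (ih : ∀ x ∈ sub q Q N (j + 1), x ∈ cosetSpan q Q N (j + 1)) :
    ofBraid q Q N (natGen N (j + 1)) * ofBraid q Q N (natConj N 1 j) *
      ofBraid q Q N (natGen N (j + 1)) ∈ cosetSpan q Q N (j + 1 + 1) := by
  obtain ⟨r, hr⟩ := exists_ofBraid_natGen_eq q Q (N := N) hj
  nth_rw 2 [hr]
  rw [mul_add, mul_smul_comm, mul_smul_comm, ← ofBraid_natConj_succ, mul_one]
  exact Submodule.add_mem _ (Submodule.smul_mem _ _ natConj_mem_cosetSpan)
    (Submodule.smul_mem _ _ (gen_mul_mem_cosetSpan (ih _ (natConj_one_mem_sub (by omega)))))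

theorem natConj_mul_gen_mem_cosetSpan {k i : ℕ} (hk : k < N)
    (ih : ∀ x ∈ sub q Q N k, x ∈ cosetSpan q Q N k) (hi : i < k + 1) :
    ofBraid q Q N (natConj N 1 k) * ofBraid q Q N (natGen N i) ∈ cosetSpan q Q N (k + 1) := by
  rcases Nat.lt_succ_iff_lt_or_eq.1 hi with h | rfl
  · have hT := mul_mem_cosetSpan (q := q) (Q := Q) (N := N) (k := k + 1) (natGen_mem_sub h)
      natConj_mem_cosetSpan
    rcases Nat.eq_zero_or_pos i with rfl | h0
    · have := Submodule.add_mem _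
        (genSpan_le_cosetSpan ih (natConj_mul_sub_mem_genSpan (q := q) (Q := Q) (N := N) h hk)) hT
      rwa [sub_add_cancel] at this
    · rwa [← ((natGen_commute_natConj_of_one (N := N) (ε := 1) h0 h hk rfl rfl).map
        (ofBraid q Q N)).eq]
  · cases i with
    | zero => exact gen_mul_self_mem_cosetSpan hk ih
    | succ j =>
      rw [ofBraid_natConj_succ, mul_assoc, ← map_mul _ _⁻¹, inv_mul_cancel, map_one, mul_one]
      exact gen_mul_mem_cosetSpan (ih _ (natConj_one_mem_sub (Nat.lt_succ_self j)))

theorem cosetRep_mul_gen_mem_cosetSpan {k i : ℕ} (hk : k < N)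
    (ih : ∀ x ∈ sub q Q N k, x ∈ cosetSpan q Q N k) (hi : i < k + 1) {c : BraidB N}
    (hc : IsCosetRep N (k + 1) c) :
    ofBraid q Q N c * ofBraid q Q N (natGen N i) ∈ cosetSpan q Q N (k + 1) := by
  cases hc with
  | one =>
    rw [map_one, one_mul]
    rcases Nat.lt_succ_iff_lt_or_eq.1 hi with h | rfl
    · exact sub_le_cosetSpan_succ _ (natGen_mem_sub h)
    · exact natGen_mem_cosetSpan ih
  | conj => exact natConj_mul_gen_mem_cosetSpan hk ih hi
  | gen_mul _ c hc =>
    rw [map_mul]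
    rcases Nat.lt_succ_iff_lt_or_eq.1 hi with h | rfl
    · rw [mul_assoc]
      exact gen_mul_mem_cosetSpan (ih _ (mul_mem hc.mem_sub (natGen_mem_sub h)))
    · cases hc with
      | one => rw [map_one, mul_one]; exact gen_mul_self_mem_cosetSpan hk ih
      | conj j => exact gen_mul_natConj_mul_gen_mem_cosetSpan hk ih
      | gen_mul j c hc =>
        rcases Nat.eq_zero_or_pos j with rfl | hj
        · cases hc
          rw [mul_one]
          exact gen_mul_natConj_mul_gen_mem_cosetSpan (j := 0) hk ih
        · have hcg : c * natGen N (j + 1) = natGen N (j + 1) * c :=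
            (hc.commute (Nat.lt_succ_self j)).eq
          have h3 := natGen_braid (N := N) hj hk
          have h4 : natGen N (j + 1) * (natGen N j * c) * natGen N (j + 1) =
              natGen N j * (natGen N (j + 1) * (natGen N j * c)) := by
            rw [mul_assoc, mul_assoc, hcg]
            simp only [← mul_assoc]
            rw [h3]
          have hm := natGen_mem_sub (q := q) (Q := Q) (N := N) (Nat.lt_succ_self j)
          rw [← map_mul, ← map_mul, h4, map_mul, map_mul]
          refine mul_mem_cosetSpan (k := j + 1 + 1) hm (gen_mul_mem_cosetSpan (ih _ ?_))
          rw [map_mul]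
          exact mul_mem hm (sub_mono (Nat.le_succ j) hc.mem_sub)

/-- The span of the products `a c` is stable under right multiplication by the generators, hence
it is everything. -/
theorem sub_le_cosetSpan {k : ℕ} (hk : k ≤ N) :
    ∀ x ∈ sub q Q N k, x ∈ cosetSpan q Q N k := by
  induction k with
  | zero =>
    intro x hx
    have h := mem_cosetSpan (k := 0) hx (.one (N := N) 0)
    rwa [map_one, mul_one] at h
  | succ k ih =>
    replace ih := ih (by omega)
    have hright : ∀ y ∈ sub q Q N (k + 1), ∀ x ∈ cosetSpan q Q N (k + 1),
        x * y ∈ cosetSpan q Q N (k + 1) := by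
      intro y hy
      refine Algebra.adjoin_induction (p := fun y _ => ∀ x ∈ cosetSpan q Q N (k + 1),
        x * y ∈ cosetSpan q Q N (k + 1)) ?_ ?_ ?_ ?_ hy
      · rintro _ ⟨i, hi, rfl⟩ x hx
        induction hx using Submodule.span_induction with
        | mem x hx =>
          obtain ⟨a, ha, c, hc, rfl⟩ := hx
          rw [mul_assoc]
          exact mul_mem_cosetSpan ha (cosetRep_mul_gen_mem_cosetSpan hk ih hi hc)
        | zero => rw [zero_mul]; exact Submodule.zero_mem _
        | add x y _ _ hx hy => rw [add_mul]; exact Submodule.add_mem _ hx hy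
        | smul r x _ hx => rw [smul_mul_assoc]; exact Submodule.smul_mem _ r hx
      · intro r x hx
        rw [← Algebra.commutes, ← Algebra.smul_def]
        exact Submodule.smul_mem _ r hx
      · intro y z _ _ hy hz x hx
        rw [mul_add]
        exact Submodule.add_mem _ (hy x hx) (hz x hx)
      · intro y z _ _ hy hz x hx
        rw [← mul_assoc]
        exact hz _ (hy x hx)
    intro x hx
    have h := hright x hx 1 (sub_le_cosetSpan_succ 1 (one_mem _))
    rwa [one_mul] at h

/-- Every element of `H_{n+1}` is a combination of products `a c` with `a ∈ H_n` and `c` a coset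
representative. -/
theorem mem_cosetSpan_self {n : ℕ} (h : HeckeB q Q (n + 1)) : h ∈ cosetSpan q Q (n + 1) (n + 1) :=
  sub_le_cosetSpan le_rfl h (by rw [sub_self]; trivial)

theorem exists_incl_eq_of_mem_sub {n : ℕ} (hN : n ≤ N) {a : HeckeB q Q N}
    (ha : a ∈ sub q Q N n) : ∃ a₀ : HeckeB q Q n, incl q Q hN a₀ = a := by
  have h : sub q Q N n ≤ (incl q Q hN).range := Algebra.adjoin_le <| by
    rintro _ ⟨i, hi, rfl⟩
    exact ⟨ofBraid q Q n (natGen n i), by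
      rw [← incl_natGen hN hi]; exact incl_ofBraid q Q hN _⟩
  exact h ha

theorem incl_incl {n k : ℕ} (hnk : n ≤ k) (hkN : k ≤ N) (a : HeckeB q Q n) :
    incl q Q hkN (incl q Q hnk a) = incl q Q (hnk.trans hkN) a := by
  have ha : a ∈ sub q Q n n := by rw [sub_self]; trivial
  refine Algebra.adjoin_induction (p := fun a _ => incl q Q hkN (incl q Q hnk a) =
    incl q Q (hnk.trans hkN) a) ?_ ?_ ?_ ?_ ha
  · rintro _ ⟨i, hi, rfl⟩
    rw [incl_ofBraid, incl_ofBraid, incl_ofBraid, incl_natGen _ hi,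
      incl_natGen _ (hi.trans_le hnk), incl_natGen _ hi]
  · intro r; simp only [AlgHom.commutes]
  · intro x y _ _ hx hy; simp only [map_add, hx, hy]
  · intro x y _ _ hx hy; simp only [map_mul, hx, hy]

theorem incl_self {n : ℕ} (hn : n ≤ n) (a : HeckeB q Q n) : incl q Q hn a = a := by
  have ha : a ∈ sub q Q n n := by rw [sub_self]; trivial
  refine Algebra.adjoin_induction (p := fun a _ => incl q Q hn a = a) ?_ ?_ ?_ ?_ ha
  · rintro _ ⟨i, hi, rfl⟩
    rw [incl_ofBraid, incl_natGen _ hi]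
  · intro r; simp only [AlgHom.commutes]
  · intro x y _ _ hx hy; simp only [map_add, hx, hy]
  · intro x y _ _ hx hy; simp only [map_mul, hx, hy]

end HeckeB

/-! ### Expansions of traces -/

namespace BraidB

/-- Names for the elements of the sets `𝒟'_{i+1,0}`: the same label names an element at every
index `i` and in every braid group. -/
inductive Label
  | one
  | gen
  | conj (ε : ℕ → ℤˣ)

namespace Label

/-- The element of the braid group named by a label at index `i`. -/
def eval (N i : ℕ) : Label → BraidB N
  | one => 1
  | gen => natGen N i
  | conj ε => natConj N ε i

/-- Multiplication of the signs in a label by a sign vector. -/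
def twist (s : ℕ → ℤˣ) : Label → Label
  | one => one
  | gen => gen
  | conj ε => conj (s * ε)

/-- The signs at the positions `1, …, n - 1` are `+`. -/
def PlusBelow (n : ℕ) (d : Label) : Prop :=
  ∀ ε, d = conj ε → ∀ l, 1 ≤ l → l < n → ε l = 1

theorem twist_one (d : Label) : d.twist 1 = d := by
  cases d <;> simp [twist]

theorem twist_twist (s u : ℕ → ℤˣ) (d : Label) : (d.twist s).twist u = d.twist (u * s) := by
  cases d <;> simp [twist, mul_assoc]

theorem incl_eval {n N i : ℕ} (hN : n ≤ N) (hi : i < n) (d : Label) :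
    incl hN (d.eval n i) = d.eval N i := by
  cases d with
  | one => exact map_one _
  | gen => exact incl_natGen hN hi
  | conj ε => exact incl_natConj hN ε hi

theorem eval_mem_dSet {N : ℕ} (i : Fin N) (d : Label) : d.eval N i ∈ dSet 0 i := by
  cases d with
  | one => exact Or.inl rfl
  | gen =>
    -- The label `gen` at index `0` names `t`, which is a `t'` with empty conjugation.
    rcases Nat.eq_zero_or_pos i.val with h | h
    · refine Or.inr (Or.inr ⟨1, fun _ _ _ => rfl, ?_⟩)
      rw [← natConj_eq_tConj, h]
      simp only [eval, natConj]
    · exact Or.inr (Or.inl ⟨h, natGen_of_lt i.isLt⟩)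
  | conj ε =>
    exact Or.inr (Or.inr ⟨ε, fun l h1 h2 => by omega, natConj_eq_tConj ε _ i.isLt⟩)

theorem exists_eval_eq {N n j : ℕ} (hj : n ≤ j) {i : Fin N} {x : BraidB N} (hx : x ∈ dSet j i) :
    ∃ d : Label, d.PlusBelow n ∧ d.eval N i = x := by
  rcases hx with rfl | ⟨-, rfl⟩ | ⟨ε, hε, rfl⟩
  · exact ⟨one, by rintro _ ⟨⟩, rfl⟩
  · exact ⟨gen, by rintro _ ⟨⟩, natGen_of_lt i.isLt⟩
  · refine ⟨conj ε, ?_, natConj_eq_tConj ε _ i.isLt⟩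
    rintro _ ⟨⟩ l h1 h2
    exact hε l h1 (by omega)

/-- Transfer of a coset representative past a single `d`. -/
theorem semiconjBy_eval {N k l : ℕ} {c : BraidB N} {s : ℕ → ℤˣ} (hs : ActsBySigns k c s)
    (hc : ∀ j, k < j → Commute c (natGen N j)) (hl : k < l) (hN : l < N) {d : Label}
    (hd : d.PlusBelow (k + 1)) : SemiconjBy c (d.eval N l) ((d.twist s).eval N l) := by
  cases d with
  | one => exact SemiconjBy.one_right _
  | gen => exact hc l hl
  | conj ε => exact hs ε (fun i h1 h2 => hd ε rfl i h1 (by omega)) l hl.le hN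

/-- The product of the `m` consecutive elements named by `x` at the indices `a, …, a + m - 1`. -/
def seg (N : ℕ) (x : ℕ → Label) (a m : ℕ) : BraidB N :=
  HeckeB.orderedProd fun k : Fin m => (x (a + k)).eval N (a + k)

theorem seg_zero (N : ℕ) (x : ℕ → Label) (a : ℕ) : seg N x a 0 = 1 := rfl

theorem seg_succ (N : ℕ) (x : ℕ → Label) (a m : ℕ) :
    seg N x a (m + 1) = (x a).eval N a * seg N x (a + 1) m := by
  simp only [seg, HeckeB.orderedProd, List.ofFn_succ, List.prod_cons, Fin.val_zero, Nat.add_zero,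
    Fin.val_succ, Nat.add_assoc, Nat.add_comm 1]

theorem seg_succ' (N : ℕ) (x : ℕ → Label) (a m : ℕ) :
    seg N x a (m + 1) = seg N x a m * (x (a + m)).eval N (a + m) := by
  simp only [seg, HeckeB.orderedProd, List.ofFn_succ', List.prod_concat, Fin.val_castSucc,
    Fin.val_last]

theorem seg_congr {N a m : ℕ} {x y : ℕ → Label} (h : ∀ i, a ≤ i → i < a + m → x i = y i) :
    seg N x a m = seg N y a m := by
  unfold seg
  congr 1
  funext k
  rw [h _ (by omega) (by omega)]

theorem incl_seg {n N : ℕ} (hN : n ≤ N) (x : ℕ → Label) {a m : ℕ} (h : a + m ≤ n) :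
    incl hN (seg n x a m) = seg N x a m := by
  induction m with
  | zero => rw [seg_zero, seg_zero, map_one]
  | succ m ih => rw [seg_succ', seg_succ', map_mul, ih (by omega), incl_eval hN (by omega)]

theorem semiconjBy_seg {N a m : ℕ} {c : BraidB N} {x y : ℕ → Label}
    (h : ∀ i, a ≤ i → i < a + m → SemiconjBy c ((x i).eval N i) ((y i).eval N i)) :
    SemiconjBy c (seg N x a m) (seg N y a m) := by
  induction m with
  | zero => exact SemiconjBy.one_right _
  | succ m ih =>
    rw [seg_succ', seg_succ']
    exact (ih fun i h1 h2 => h i h1 (by omega)).mul_right (h _ (by omega) (by omega))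

end Label

end BraidB

namespace HeckeB

open BraidB Label

variable {A : Type*} [CommRing A] {q Q : Aˣ}

/-- The trace values of `h d_{n+1} ⋯ d_{n+m}` expand along a list of triples `(r, x, s)`: the
summand of such a triple is `r` times the trace of the product named by `x`, followed by the
elements `d_{n+k}` with signs multiplied by `s`. Neither the list nor the sign vectors depend on
`m` and the `d_{n+k}`; that the change of the `d_{n+k}` is given by one vector is what keeps the
induction on `n` going, since it makes the `n`-th factor independent of the later ones. Only the
signs at `1, …, n - 1` of the `d_{n+k}` have to be `+`. -/
def HasExpansion {n : ℕ} (h : HeckeB q Q n) : Prop :=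
  ∃ L : List (A × (ℕ → Label) × (ℕ → ℤˣ)), ∀ (N m : ℕ) (hN : n ≤ N), n + m = N →
    ∀ d : ℕ → Label, (∀ i, (d i).PlusBelow n) →
    ∀ φ : HeckeB q Q N →ₗ[A] A, IsTraceFunction φ →
      φ (incl q Q hN h * ofBraid q Q N (seg N d n m)) =
        (L.map fun p => p.1 * φ (ofBraid q Q N
          (seg N p.2.1 0 n * seg N (fun i => (d i).twist p.2.2) n m))).sum

theorem HasExpansion.zero {n : ℕ} : HasExpansion (0 : HeckeB q Q n) :=
  ⟨[], fun N m hN _ d _ φ _ => by simp⟩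

theorem HasExpansion.add {n : ℕ} {h h' : HeckeB q Q n} (H : HasExpansion h)
    (H' : HasExpansion h') : HasExpansion (h + h') := by
  obtain ⟨L, hL⟩ := H
  obtain ⟨L', hL'⟩ := H'
  refine ⟨L ++ L', fun N m hN hm d hd φ hφ => ?_⟩
  rw [map_add, add_mul, map_add, hL N m hN hm d hd φ hφ, hL' N m hN hm d hd φ hφ, List.map_append,
    List.sum_append]

theorem HasExpansion.smul {n : ℕ} {h : HeckeB q Q n} (r : A) (H : HasExpansion h) :
    HasExpansion (r • h) := by
  obtain ⟨L, hL⟩ := H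
  refine ⟨L.map fun p => (r * p.1, p.2), fun N m hN hm d hd φ hφ => ?_⟩
  rw [map_smul, smul_mul_assoc, map_smul, hL N m hN hm d hd φ hφ, smul_eq_mul,
    ← List.sum_map_mul_left, List.map_map]
  simp only [Function.comp_def, mul_assoc]

/-- The induction step for a product `a δ b`: move `b` past the `d_{n+1+k}`, changing their signs
at most at `n`, and then, by the trace property, to the front, where it joins `a` in `H_n`. -/
theorem HasExpansion.mul_mul {n : ℕ} {δ : Label} (hδ : δ.PlusBelow n) {b : BraidB n}
    (hb : IsCosetRep n n b) {a : HeckeB q Q n} (H : HasExpansion (ofBraid q Q n b * a)) :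
    HasExpansion (incl q Q (Nat.le_succ n) a * ofBraid q Q (n + 1) (δ.eval (n + 1) n) *
      ofBraid q Q (n + 1) (BraidB.incl (Nat.le_succ n) b)) := by
  obtain ⟨L, hL⟩ := H
  obtain ⟨s, hs, hact⟩ := hb.exists_actsBySigns le_rfl
  refine ⟨L.map fun p => (p.1, Function.update p.2.1 n (δ.twist p.2.2), p.2.2 * s),
    fun N m hN hm d hd φ hφ => ?_⟩
  have hn : n ≤ N := by omega
  set d' : ℕ → Label := Function.update (fun i => (d i).twist s) n δ with hd'
  have hd'n : d' n = δ := by rw [hd', Function.update_self]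
  have hd'l : ∀ i, n + 1 ≤ i → d' i = (d i).twist s := fun i hi => by
    rw [hd', Function.update_of_ne (by omega)]
  have hplus : ∀ i, (d' i).PlusBelow n := by
    intro i
    by_cases hi : i = n
    · rw [hi, hd'n]; exact hδ
    · rw [hd', Function.update_of_ne hi]
      intro ε hε l h1 h2
      cases h : d i with
      | one => rw [h] at hε; cases hε
      | gen => rw [h] at hε; cases hε
      | conj ε₀ =>
        rw [h] at hε
        cases hε
        have h3 := hd i ε₀ h l h1 (by omega)
        rcases hs with rfl | rfl
        · rw [one_mul, h3]
        · rw [mulSingle_mul_apply_of_ne _ (by omega), h3]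
  have hcomm : ∀ j, n < j → Commute (BraidB.incl hn b) (natGen N j) := fun j hj =>
    (hb.map_incl hn le_rfl).commute hj
  have hmove : SemiconjBy (BraidB.incl hn b) (seg N d (n + 1) m) (seg N d' (n + 1) m) := by
    refine semiconjBy_seg fun i h1 h2 => ?_
    rw [hd'l i h1]
    exact semiconjBy_eval (hact N hn) hcomm h1 (by omega) (hd i)
  have key := hL N (m + 1) hn (by omega) d' hplus φ hφ
  have hbb : BraidB.incl hN (BraidB.incl (Nat.le_succ n) b) = BraidB.incl hn b :=
    BraidB.incl_incl _ _ b
  have h1 : incl q Q hN (incl q Q (Nat.le_succ n) a * ofBraid q Q (n + 1) (δ.eval (n + 1) n) *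
      ofBraid q Q (n + 1) (BraidB.incl (Nat.le_succ n) b)) * ofBraid q Q N (seg N d (n + 1) m) =
      (incl q Q hn a * ofBraid q Q N (seg N d' n (m + 1))) *
        ofBraid q Q N (BraidB.incl hn b) := by
    rw [map_mul, map_mul, incl_incl, incl_ofBraid, incl_ofBraid, hbb,
      incl_eval hN (Nat.lt_succ_self n), mul_assoc, mul_assoc, mul_assoc, ← map_mul, hmove.eq,
      ← map_mul, ← map_mul, seg_succ, hd'n, mul_assoc]
  rw [h1, hφ, ← mul_assoc, ← incl_ofBraid q Q hn, ← map_mul, key, List.map_map]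
  congr 1
  refine List.map_congr_left fun p _ => ?_
  simp only [Function.comp_apply]
  congr 3
  rw [seg_succ, hd'n, ← mul_assoc, seg_succ', Nat.zero_add, Function.update_self]
  congr 1
  · congr 1
    exact seg_congr fun i _ h2 => by rw [Function.update_of_ne (by omega)]
  · exact seg_congr fun i h2 _ => by rw [hd'l i h2, twist_twist]

theorem hasExpansion {n : ℕ} (h : HeckeB q Q n) : HasExpansion h := by
  induction n with
  | zero =>
    have hh : h ∈ sub q Q 0 0 := by rw [sub_self]; trivial
    obtain ⟨r, rfl⟩ := mem_sub_zero hh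
    refine ⟨[(r, fun _ => one, 1)], fun N m hN hm d hd φ hφ => ?_⟩
    simp only [AlgHom.commutes, ← Algebra.smul_def, map_smul, List.map_cons, List.map_nil,
      List.sum_singleton, seg_zero, one_mul, twist_one, smul_eq_mul]
  | succ n ih =>
    have hspan := mem_cosetSpan_self h
    induction hspan using Submodule.span_induction with
    | mem x hx =>
      obtain ⟨a, ha, c, hc, rfl⟩ := hx
      obtain ⟨a, rfl⟩ := exists_incl_eq_of_mem_sub (Nat.le_succ n) ha
      cases hc with
      | one =>
        have := HasExpansion.mul_mul (δ := one) (by rintro _ ⟨⟩) (.one n) (a := a) (ih _)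
        simpa only [eval, map_one, mul_one] using this
      | conj =>
        have := HasExpansion.mul_mul (δ := conj 1) (by rintro _ ⟨⟩ _ _ _; rfl) (.one n) (a := a)
          (ih _)
        simpa only [eval, map_one, mul_one] using this
      | gen_mul _ c hc =>
        obtain ⟨c₀, hc₀, rfl⟩ := hc.exists_incl_eq (Nat.le_succ n) le_rfl
        have := HasExpansion.mul_mul (δ := gen) (by rintro _ ⟨⟩) hc₀ (a := a) (ih _)
        simpa only [eval, map_mul, mul_assoc] using this
    | zero => exact .zero
    | add x y _ _ hx hy => exact hx.add hy
    | smul r x _ hx => exact hx.smul r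

theorem map_orderedProd {M M' F : Type*} [Monoid M] [Monoid M'] [FunLike F M M']
    [MonoidHomClass F M M'] (f : F) {m : ℕ} (d : Fin m → M) :
    f (orderedProd d) = orderedProd fun k => f (d k) := by
  simp only [orderedProd, map_list_prod, List.map_ofFn, Function.comp_def]

theorem ofBraid_eval_mem_D {N : ℕ} (i : Fin N) (d : Label) :
    ofBraid q Q N (d.eval N i) ∈ D q Q 0 i := ⟨_, eval_mem_dSet i d, rfl⟩

/-- A finite family of summands `r f(x)` can be replaced by a finite set of pairs, by adding the
coefficients of equal `x`. -/
theorem exists_finset_sum_eq {R X ι : Type*} [Semiring R] [Fintype ι] [Nonempty ι]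
    (I : ι → R × X) : ∃ J : Finset (R × X), J.Nonempty ∧
      ∀ f : X → R, ∑ a, (I a).1 * f (I a).2 = ∑ p ∈ J, p.1 * f p.2 := by
  classical
  refine ⟨(Finset.univ.image fun a => (I a).2).image
    fun x => (∑ a with (I a).2 = x, (I a).1, x), ?_, fun f => ?_⟩
  · exact (Finset.univ_nonempty.image _).image _
  · rw [Finset.sum_image fun x _ y _ h => (Prod.ext_iff.1 h).2,
      ← Finset.sum_fiberwise_of_maps_to (g := fun a => (I a).2)
        (t := Finset.univ.image fun a => (I a).2) fun a ha => Finset.mem_image_of_mem _ ha]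
    refine Finset.sum_congr rfl fun x _ => ?_
    rw [Finset.sum_mul]
    refine Finset.sum_congr rfl fun a ha => ?_
    rw [(Finset.mem_filter.1 ha).2]

/-- The expansion of `h`, with labels replaced by the elements they name. -/
theorem exists_family {n : ℕ} (h : HeckeB q Q n) :
    ∃ (N : ℕ) (I : Fin N → A × ((i : Fin n) → D q Q 0 i)), 0 < N ∧
      (∀ φ : HeckeB q Q n →ₗ[A] A, IsTraceFunction φ →
        φ h = ∑ a, (I a).1 * φ (orderedProd fun i => ((I a).2 i : HeckeB q Q n))) ∧
      ∀ (m : ℕ) (d : (k : Fin m) → D q Q (n + k) (Fin.natAdd n k)),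
        ∃ e : Fin N → (k : Fin m) → D q Q 0 (Fin.natAdd n k),
          ∀ φ : HeckeB q Q (n + m) →ₗ[A] A, IsTraceFunction φ →
            φ (incl q Q (Nat.le_add_right n m) h *
                orderedProd fun k => (d k : HeckeB q Q (n + m))) =
              ∑ a, (I a).1 *
                φ (incl q Q (Nat.le_add_right n m)
                    (orderedProd fun i => ((I a).2 i : HeckeB q Q n)) *
                  orderedProd fun k => (e a k : HeckeB q Q (n + m))) := by
  obtain ⟨L₀, hL₀⟩ := hasExpansion h
  -- A summand with coefficient `0` makes the family non-empty.
  obtain ⟨L, hL, hpos⟩ : ∃ L : List (A × (ℕ → Label) × (ℕ → ℤˣ)), (∀ (N m : ℕ) (hN : n ≤ N),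
      n + m = N → ∀ d : ℕ → Label, (∀ i, (d i).PlusBelow n) →
      ∀ φ : HeckeB q Q N →ₗ[A] A, IsTraceFunction φ →
      φ (incl q Q hN h * ofBraid q Q N (seg N d n m)) =
        ∑ a : Fin L.length, L[a].1 * φ (ofBraid q Q N
          (seg N L[a].2.1 0 n * seg N (fun i => (d i).twist L[a].2.2) n m))) ∧
      0 < L.length := by
    refine ⟨(0, fun _ => one, 1) :: L₀, fun N m hN hm d hd φ hφ => ?_, Nat.succ_pos _⟩
    rw [hL₀ N m hN hm d hd φ hφ]
    symm
    refine (Fin.sum_univ_fun_getElem ((0, fun _ => one, 1) :: L₀) (fun p => p.1 * φ (ofBraid q Q N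
          (seg N p.2.1 0 n * seg N (fun i => (d i).twist p.2.2) n m)))).trans ?_
    rw [List.map_cons, List.sum_cons, zero_mul, zero_add]
  have hseg : ∀ (x : ℕ → Label), (orderedProd fun i : Fin n => ofBraid q Q n ((x i).eval n i)) =
      ofBraid q Q n (seg n x 0 n) := fun x => by
    rw [seg, map_orderedProd]
    simp only [Nat.zero_add]
  refine ⟨L.length, fun a => (L[a].1, fun i => ⟨_, ofBraid_eval_mem_D i (L[a].2.1 i)⟩), hpos,
    fun φ hφ => ?_, fun m d => ?_⟩
  · have := hL n 0 le_rfl rfl (fun _ => one) (by rintro _ _ ⟨⟩) φ hφ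
    simp only [seg_zero, map_one, mul_one, incl_self] at this
    simp only [hseg, this]
  · have hd : ∀ k : Fin m, ∃ w : Label, w.PlusBelow n ∧
        ofBraid q Q (n + m) (w.eval (n + m) (n + k)) = d k := fun k => by
      obtain ⟨x, hx, hxd⟩ := (d k).2
      obtain ⟨w, hw, hwx⟩ := exists_eval_eq (Nat.le_add_right n k) hx
      exact ⟨w, hw, by rw [← hxd, ← hwx]; rfl⟩
    choose w hw hwd using hd
    obtain ⟨v, hv, hvw⟩ : ∃ v : ℕ → Label, (∀ i, (v i).PlusBelow n) ∧
        ∀ k : Fin m, v (n + k) = w k := by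
      refine ⟨fun i => if hi : i - n < m then w ⟨i - n, hi⟩ else one, fun i => ?_, fun k => ?_⟩
      · dsimp only
        split_ifs
        · exact hw _
        · rintro _ ⟨⟩
      · simp
    refine ⟨fun a k => ⟨_, ofBraid_eval_mem_D (Fin.natAdd n k) ((v (n + k)).twist L[a].2.2)⟩,
      fun φ hφ => ?_⟩
    have h1 := hL (n + m) m (Nat.le_add_right n m) rfl v hv φ hφ
    have hseg' : ∀ x : ℕ → Label, (orderedProd fun k : Fin m =>
        ofBraid q Q (n + m) ((x (n + k)).eval (n + m) (n + k))) =
          ofBraid q Q (n + m) (seg (n + m) x n m) := fun x => by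
      rw [seg, map_orderedProd]
    have h2 : (orderedProd fun k => (d k : HeckeB q Q (n + m))) =
        ofBraid q Q (n + m) (seg (n + m) v n m) := by
      rw [← hseg']
      simp only [hvw, hwd]
    rw [h2, h1]
    refine Finset.sum_congr rfl fun a _ => ?_
    dsimp only
    rw [hseg, incl_ofBraid, incl_seg _ _ (by omega), map_mul, ← hseg']
    rfl

end HeckeB
theorem proposition3p4 {A : Type*} [CommRing A] (q Q : Aˣ) (n : ℕ) (h : HeckeB q Q n) :
    (∃ I : Finset (A × ((i : Fin n) → HeckeB.D q Q 0 i)), I.Nonempty ∧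
      ∀ φ : HeckeB q Q n →ₗ[A] A, HeckeB.IsTraceFunction φ →
        φ h = ∑ p ∈ I, p.1 * φ (HeckeB.orderedProd fun i => (p.2 i : HeckeB q Q n))) ∧
    (∃ (N : ℕ) (I : Fin N → A × ((i : Fin n) → HeckeB.D q Q 0 i)), 0 < N ∧
      (∀ φ : HeckeB q Q n →ₗ[A] A, HeckeB.IsTraceFunction φ →
        φ h = ∑ a, (I a).1 * φ (HeckeB.orderedProd fun i => ((I a).2 i : HeckeB q Q n))) ∧
      ∀ (m : ℕ) (d : (k : Fin m) → HeckeB.D q Q (n + k) (Fin.natAdd n k)),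
        ∃ e : Fin N → (k : Fin m) → HeckeB.D q Q 0 (Fin.natAdd n k),
          ∀ φ : HeckeB q Q (n + m) →ₗ[A] A, HeckeB.IsTraceFunction φ →
            φ (HeckeB.incl q Q (Nat.le_add_right n m) h *
                HeckeB.orderedProd fun k => (d k : HeckeB q Q (n + m))) =
              ∑ a, (I a).1 *
                φ (HeckeB.incl q Q (Nat.le_add_right n m)
                    (HeckeB.orderedProd fun i => ((I a).2 i : HeckeB q Q n)) *
                  HeckeB.orderedProd fun k => (e a k : HeckeB q Q (n + m)))) := by

  obtain ⟨N, I, hN, h1, h2⟩ := HeckeB.exists_family h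
  have : Nonempty (Fin N) := ⟨⟨0, hN⟩⟩
  obtain ⟨J, hJ, hIJ⟩ := HeckeB.exists_finset_sum_eq I
  exact ⟨⟨J, hJ, fun φ hφ => (h1 φ hφ).trans (hIJ fun x => φ (HeckeB.orderedProd fun i => x i))⟩,
    N, I, hN, h1, h2⟩
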